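/- Let $\mathbb G$ be a step-$s$ Carnot group, i.e. a connected, simply connected Lie group whose Lie algebra is stratified, $\mathfrak g=V_1\oplus\cdots\oplus V_s$ with nonzero layers, $[V_1,V_i]=V_{i+1}$ for $1\le i<s$ and $[V_1,V_s]=\{0\}$. Write $0$ for the identity, let $\delta_t$ $(t>0)$ be the dilations, $\delta_t(\exp(X_1+\cdots+X_s))=\exp(tX_1+t^2X_2+\cdots+t^sX_s)$ for $X_i\in V_i$, and let $d$ be any left-invariant metric on $\mathbb G$ with $d(\delta_t p,\delta_t q)=t\,d(p,q)$ for all $t>0$. A horizontal line is a set $L=\{\exp(tX):t\in\mathbb R\}$ with $0\ne X\in V_1$, and $\mathcal H^1$ is the $1$-dimensional Hausdorff measure of $(\mathbb G,d)$. A $1$-dimensional Calderón–Zygmund (CZ) kernel is a continuous function $K:\mathbb G\setminus\{0\}\to\mathbb R$ for which there are $B>0$ and $\beta\in(0,1]$ with $|K(p)|\le B/d(p,0)$ for $p\neq 0$ and $$|K(q^{-1}p_1)-K(q^{-1}p_2)|+|K(p_1^{-1}q)-K(p_2^{-1}q)|\le B\,\frac{d(p_1,p_2)^\beta}{d(p_1,q)^{1+\beta}}$$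 whenever $p_1\ne q$ and $d(p_1,p_2)\le d(p_1,q)/2$. $K$ is uniformly bounded on horizontal lines (UBHL) if there is a constant $C$ such that for every horizontal line $L$, with $\mu=\mathcal H^1|_L$, and every $\varepsilon>0$ the operator $T_{\mu,\varepsilon}f(p)=\int_{d(p,q)>\varepsilon}K(q^{-1}p)f(q)\,d\mu(q)$ is bounded on $L^2(\mu)$ with norm at most $C$. $K$ satisfies the annular boundedness condition for a class $\Psi$ of functions $\psi:\mathbb G\to\mathbb R$ if for every $\psi\in\Psi$ there is a constant $A\ge1$ (possibly depending on $\psi$) such that $$\left|\int_L[\psi^R(p)-\psi^r(p)]\,K(p)\,d\mathcal H^1(p)\right|\le A\qquad\text{for all }0<r<R\text{ and every horizontal line }L,$$ where $\psi^r=\psi\circ\delta_{1/r}$. Consider the following two classes of radial functions $\psi(p)=f(d(p,0))$, $f:[0,\infty)\to\mathbb R$, with $\chi_{B(0,1/2)}\le\psi\le\chi_{B(0,2)}$: the class $\Psi_1$ of those with a $C^\infty$ profile $f$ on $[0,\infty)$, and the class $\Psi_2$ of those for which $\psi$ is a $C^\infty$ function on the manifold $\mathbb G$. Let $K$ be a $1$-dimensional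 CZ kernel. Then $K$ is UBHL if and only if it satisfies the annular boundedness condition for $\Psi_1$. If $\Psi_2$ is non-empty (which is the case exactly when $p\mapsto d(p,0)$ is $C^\infty$ on $\mathbb G\setminus\{0\}$), then $K$ is UBHL if and only if it satisfies the annular boundedness condition for $\Psi_2$. -/

import Mathlib

open Set MeasureTheory Finset
open scoped Manifold ContDiff NNReal ENNReal

noncomputable section

namespace Carnot

section

variable {E : Type*} [NormedAddCommGroup E] [NormedSpace ℝ E]
  {G : Type*} [TopologicalSpace G] [ChartedSpace E G] [Group G]

/-- `γ` is the smooth one-parameter subgroup `t ↦ exp (t X)` of the Lie group `G`, where `X` is an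
element of the Lie algebra (the tangent space at `1`, with the bracket of left-invariant vector
fields). -/
structure IsOneParam (X : GroupLieAlgebra 𝓘(ℝ, E) G) (γ : ℝ → G) : Prop where
  smooth : ContMDiff 𝓘(ℝ, ℝ) 𝓘(ℝ, E) ∞ γ
  map_add : ∀ s t : ℝ, γ (s + t) = γ s * γ t
  velocity : mfderiv 𝓘(ℝ, ℝ) 𝓘(ℝ, E) γ 0 (1 : ℝ) = X

/-- `p = exp X`. -/
def IsExp (X : GroupLieAlgebra 𝓘(ℝ, E) G) (p : G) : Prop :=
  ∃ γ : ℝ → G, IsOneParam X γ ∧ γ 1 = p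

variable (E G) in
/-- A step-`s` stratification `𝔤 = V₁ ⊕ ⋯ ⊕ V_s` of the Lie algebra of `G`, with nonzero layers,
`[V₁, V_i] = V_{i+1}` for `1 ≤ i < s` and `[V₁, V_s] = 0`.  The layers are indexed by `1, …, s`;
the values of `layer` at other indices play no role. -/
structure Stratification (s : ℕ) where
  layer : ℕ → Submodule ℝ (GroupLieAlgebra 𝓘(ℝ, E) G)
  one_le_step : 1 ≤ s
  layer_ne_bot : ∀ i ∈ Finset.Icc 1 s, layer i ≠ ⊥
  isInternal : DirectSum.IsInternal (fun i : Finset.Icc 1 s => layer i)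
  bracket_layer : ∀ i, 1 ≤ i → i < s →
    Submodule.span ℝ {Z | ∃ X ∈ layer 1, ∃ Y ∈ layer i, ⁅X, Y⁆ = Z} = layer (i + 1)
  bracket_last : ∀ X ∈ layer 1, ∀ Y ∈ layer s, ⁅X, Y⁆ = 0

variable {s : ℕ}

/-- `q = δ_t p`, i.e. `p = exp (X₁ + ⋯ + X_s)` and `q = exp (t X₁ + t² X₂ + ⋯ + t^s X_s)` with
`X_i ∈ V_i`.  Since `exp` is bijective for a Carnot group, this is the graph of a map. -/
def IsDilate (S : Stratification E G s) (t : ℝ) (p q : G) : Prop :=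
  ∃ X : ℕ → GroupLieAlgebra 𝓘(ℝ, E) G, (∀ i ∈ Finset.Icc 1 s, X i ∈ S.layer i) ∧
    IsExp (∑ i ∈ Finset.Icc 1 s, X i) p ∧ IsExp (∑ i ∈ Finset.Icc 1 s, t ^ i • X i) q

/-- The dilation `δ_t : G → G`, the map whose graph is `IsDilate S t`. -/
def dilate (S : Stratification E G s) (t : ℝ) (p : G) : G :=
  Classical.epsilon (fun q => IsDilate S t p q)

/-- Horizontal lines through the identity, `L = {exp (t X) : t ∈ ℝ}` with `0 ≠ X ∈ V₁`. -/
def IsHorizontalLine (S : Stratification E G s) (L : Set G) : Prop :=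
  ∃ X ∈ S.layer 1, X ≠ 0 ∧ ∃ γ : ℝ → G, IsOneParam X γ ∧ L = Set.range γ

/-- A left-invariant homogeneous metric on `G`: `d (g p) (g q) = d p q` and
`d (δ_t p) (δ_t q) = t * d p q` for `t > 0`. -/
structure HomogeneousMetric (S : Stratification E G s) where
  d : G → G → ℝ
  d_self : ∀ p, d p p = 0
  eq_of_d_eq_zero : ∀ {p q}, d p q = 0 → p = q
  d_comm : ∀ p q, d p q = d q p
  d_triangle : ∀ p q r, d p r ≤ d p q + d q r
  left_invariant : ∀ g p q, d (g * p) (g * q) = d p q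
  homogeneous : ∀ t : ℝ, 0 < t → ∀ p q p' q' : G, IsDilate S t p p' → IsDilate S t q q' →
    d p' q' = t * d p q

variable {S : Stratification E G s}

/-- The metric space `(G, d)`: a copy of `G` whose distance, topology and Borel `σ`-algebra are those
of `d`. -/
def HomogeneousMetric.Space (_D : HomogeneousMetric S) : Type _ := G

instance (D : HomogeneousMetric S) : Group D.Space := inferInstanceAs (Group G)

instance (D : HomogeneousMetric S) : MetricSpace D.Space where
  dist p q := D.d p q
  dist_self := D.d_self
  dist_comm := D.d_comm
  dist_triangle := D.d_triangle
  eq_of_dist_eq_zero := D.eq_of_d_eq_zero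

instance (D : HomogeneousMetric S) : MeasurableSpace D.Space := borel D.Space

instance (D : HomogeneousMetric S) : BorelSpace D.Space := ⟨rfl⟩

/-- The restriction `ℋ¹|_L` to `L ⊆ G` of the 1-dimensional Hausdorff measure of `(G, d)`. -/
def HomogeneousMetric.lineMeasure (D : HomogeneousMetric S) (L : Set G) : Measure D.Space :=
  (Measure.hausdorffMeasure 1 : Measure D.Space).restrict (L : Set D.Space)

/-- `K` is a 1-dimensional Calderón-Zygmund kernel.  A kernel `G ∖ {1} → ℝ` is represented by a
function on `G` whose value at `1` is irrelevant. -/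
def IsCZKernel (D : HomogeneousMetric S) (K : G → ℝ) : Prop :=
  ContinuousOn K {1}ᶜ ∧
  ∃ B : ℝ, 0 < B ∧ ∃ β : ℝ, 0 < β ∧ β ≤ 1 ∧
    (∀ p : G, p ≠ 1 → |K p| ≤ B / D.d p 1) ∧
    ∀ p₁ p₂ q : G, p₁ ≠ q → D.d p₁ p₂ ≤ D.d p₁ q / 2 →
      |K (q⁻¹ * p₁) - K (q⁻¹ * p₂)| + |K (p₁⁻¹ * q) - K (p₂⁻¹ * q)|
        ≤ B * (D.d p₁ p₂ ^ β / D.d p₁ q ^ (1 + β))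

/-- The truncated singular integral `T_{μ,ε} f (p) = ∫_{d(p,q) > ε} K(q⁻¹ p) f(q) dμ(q)`. -/
def truncatedSIO (D : HomogeneousMetric S) (K : G → ℝ) (μ : Measure D.Space) (ε : ℝ)
    (f : D.Space → ℝ) (p : D.Space) : ℝ :=
  ∫ q in {q : D.Space | ε < dist p q}, K (q⁻¹ * p) * f q ∂μ

/-- The operators `T_{μ,ε}`, `ε > 0`, are all bounded on `L²(μ)` with norm at most `C`. -/
def SIOBoundedL2 (D : HomogeneousMetric S) (K : G → ℝ) (μ : Measure D.Space) (C : ℝ≥0) : Prop :=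
  ∀ ε : ℝ, 0 < ε → ∀ f : D.Space → ℝ, MemLp f 2 μ →
    MemLp (truncatedSIO D K μ ε f) 2 μ ∧
      eLpNorm (truncatedSIO D K μ ε f) 2 μ ≤ C * eLpNorm f 2 μ

/-- `K` is uniformly bounded on horizontal lines (UBHL). -/
def IsUBHL (D : HomogeneousMetric S) (K : G → ℝ) : Prop :=
  ∃ C : ℝ≥0, ∀ L : Set G, IsHorizontalLine S L → SIOBoundedL2 D K (D.lineMeasure L) C

/-- `χ_{B(0,1/2)} ≤ ψ ≤ χ_{B(0,2)}`. -/
def IsCutoff (D : HomogeneousMetric S) (ψ : G → ℝ) : Prop :=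
  ∀ p : G, Set.indicator {q : G | D.d q 1 < 1 / 2} (fun _ => (1 : ℝ)) p ≤ ψ p ∧
    ψ p ≤ Set.indicator {q : G | D.d q 1 < 2} (fun _ => (1 : ℝ)) p

/-- The cutoffs `ψ(p) = f(d(p,0))` with a `C^∞` profile `f : [0,∞) → ℝ`. -/
def smoothProfileCutoffs (D : HomogeneousMetric S) : Set (G → ℝ) :=
  {ψ | (∃ f : ℝ → ℝ, ContDiffOn ℝ ∞ f (Set.Ici 0) ∧ ∀ p, ψ p = f (D.d p 1)) ∧ IsCutoff D ψ}

/-- The cutoffs that are `G`-radial and are `C^∞` as functions on the manifold `G`. -/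
def smoothRadialCutoffs (D : HomogeneousMetric S) : Set (G → ℝ) :=
  {ψ | (∃ f : ℝ → ℝ, ∀ p, ψ p = f (D.d p 1)) ∧ ContMDiff 𝓘(ℝ, E) 𝓘(ℝ, ℝ) ∞ ψ ∧ IsCutoff D ψ}

/-- The annular boundedness condition for the class `Ψ` of cutoffs: for every `ψ ∈ Ψ` the integrals
of `(ψ^R - ψ^r) K` over horizontal lines are bounded uniformly in the line and in `0 < r < R`, where
`ψ^r = ψ ∘ δ_{1/r}`. -/
def AnnularBoundedness (D : HomogeneousMetric S) (Ψ : Set (G → ℝ)) (K : G → ℝ) : Prop :=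
  ∀ ψ ∈ Ψ, ∃ A : ℝ, 1 ≤ A ∧ ∀ L : Set G, IsHorizontalLine S L → ∀ r R : ℝ, 0 < r → r < R →
    |∫ p : D.Space, (ψ (dilate S (1 / R) p) - ψ (dilate S (1 / r) p)) * K p ∂(D.lineMeasure L)| ≤ A

end

end Carnot

end

/-!
A homogeneous left-invariant metric turns every horizontal line into an isometric copy of `ℝ`: a
one-parameter subgroup `γ` with velocity in the first layer satisfies `δ_t (γ u) = γ (t u)`, so
`d (γ u) (γ v) = c |u - v|` with `c = d (γ 1) 1`, and `c ≠ 0` because a constant `γ` has velocity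
`0`. After rescaling by `c` this gives an arc-length parametrization `φ` which is a group
homomorphism, pushes Lebesgue measure forward to `ℋ¹|_L`, and turns `K` into a Calderón-Zygmund
convolution kernel `k = K ∘ φ` on `ℝ` with constants independent of the line. Dilations are
needed only on lines, where they exist by inspection, and homogeneity of the metric makes them
single-valued, so the bijectivity of `exp` plays no role
(`IsHorizontalLine.exists_isLineParam`, `IsLineParam.sioBoundedL2_iff`).

On `ℝ`, both conditions are equivalent to a uniform bound on the sharp annular integrals
`∫_{r < |t| ≤ R} k`.

* Replacing the sharp cutoffs by `ψ` changes the integral by at most `16 B`, by the size bound alone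
  (`IsRealCZKernel.abs_integral_cutoff_sub_shell_le`). Only measurability of the profile matters, so
  all classes of cutoffs are treated at once.
* Bounded truncations `T_r`, `T_R` are tested on the indicator of `[-2R, 2R]`: on `[-R, R]` the
  difference `T_r - T_R` is constant and equal to the annular integral
  (`IsRealCZKernel.abs_integral_shell_le_of_boundedTruncations`).
* Conversely, bounded annular integrals bound the Fourier transforms of the truncated kernels
  (`IsRealCZKernel.norm_fourier_shell_le`): at frequency `ξ`, the range `|t| ≤ 1 / |ξ|` is handled by
  cancellation and the range `|t| ≥ 1 / |ξ|` by a shift of half a period and Hölder regularity.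
  Plancherel's theorem, first for test functions and then by density and Fatou's lemma, turns this
  into `L²` bounds (`eLpNorm_convolution_le`, `IsRealCZKernel.boundedTruncations`).
-/

namespace Carnot

/-! ### Convolution operators on `L²(ℝ)` -/

section Multiplier

open FourierTransform Convolution Filter Topology

theorem convolutionExists_of_memLp_two {g f : ℝ → ℂ} (hg : MemLp g 2) (hf : MemLp f 2) :
    ConvolutionExists g f (ContinuousLinearMap.mul ℂ ℂ) := fun x =>
  hg.integrable_mul (hf.comp_measurePreserving (Measure.measurePreserving_sub_left volume x))

theorem enorm_convolution_le {g f : ℝ → ℂ} (hg : MemLp g 2) (hf : MemLp f 2) (x : ℝ) :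
    ‖(g ⋆[ContinuousLinearMap.mul ℂ ℂ] f) x‖ₑ ≤ eLpNorm g 2 volume * eLpNorm f 2 volume := by
  have hmp := Measure.measurePreserving_sub_left (volume : Measure ℝ) x
  calc ‖(g ⋆[ContinuousLinearMap.mul ℂ ℂ] f) x‖ₑ
      ≤ eLpNorm (g • fun t => f (x - t)) 1 volume := by
        rw [eLpNorm_one_eq_lintegral_enorm]
        exact enorm_integral_le_lintegral_enorm _
    _ ≤ eLpNorm g 2 volume * eLpNorm (fun t => f (x - t)) 2 volume :=
        eLpNorm_smul_le_mul_eLpNorm (hf.comp_measurePreserving hmp).1 hg.1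
    _ = eLpNorm g 2 volume * eLpNorm f 2 volume := by
        rw [← eLpNorm_comp_measurePreserving hf.1 hmp]
        rfl

/-- The convolution of an integrable compactly supported function with a test function is again a
test function, so that Plancherel's theorem for Schwartz functions applies to it. -/
theorem eLpNorm_convolution_le_of_contDiff {g f : ℝ → ℂ} {M : ℝ≥0} (hg : Integrable g)
    (hgc : HasCompactSupport g) (hM : ∀ ξ, ‖𝓕 g ξ‖ ≤ M) (hfc : HasCompactSupport f)
    (hf : ContDiff ℝ ∞ f) :
    eLpNorm (g ⋆[ContinuousLinearMap.mul ℂ ℂ] f) 2 volume ≤ M * eLpNorm f 2 volume := by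
  have hfi : Integrable f := hf.continuous.integrable_of_hasCompactSupport hfc
  have hhc : HasCompactSupport (g ⋆[ContinuousLinearMap.mul ℂ ℂ] f) := hgc.convolution _ hfc
  have hh : ContDiff ℝ ∞ (g ⋆[ContinuousLinearMap.mul ℂ ℂ] f) :=
    hfc.contDiff_convolution_right
      ((ContinuousLinearMap.mul ℂ ℂ).bilinearRestrictScalars ℝ) hg.locallyIntegrable hf
  have planch : ∀ H : SchwartzMap ℝ ℂ,
      eLpNorm H 2 volume = eLpNorm (𝓕 H : SchwartzMap ℝ ℂ) 2 volume := by
    intro H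
    rw [← eLpNorm_congr_ae (SchwartzMap.coeFn_toLp H 2 volume),
      ← eLpNorm_congr_ae (SchwartzMap.coeFn_toLp (𝓕 H : SchwartzMap ℝ ℂ) 2 volume),
      ← Lp.enorm_def, ← Lp.enorm_def, ← ofReal_norm, ← ofReal_norm, SchwartzMap.norm_fourier_toL2_eq]
  have h1 := planch (hhc.toSchwartzMap hh)
  have h2 := planch (hfc.toSchwartzMap hf)
  have e1 : ((hhc.toSchwartzMap hh : SchwartzMap ℝ ℂ) : ℝ → ℂ)
    = g ⋆[ContinuousLinearMap.mul ℂ ℂ] f := rfl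
  have e2 : ((hfc.toSchwartzMap hf : SchwartzMap ℝ ℂ) : ℝ → ℂ) = f := rfl
  rw [SchwartzMap.fourier_coe, e1] at h1
  rw [SchwartzMap.fourier_coe, e2] at h2
  rw [h1, h2]
  have hpt := eLpNorm_le_nnreal_smul_eLpNorm_of_ae_le_mul (μ := volume) (c := M)
    (f := 𝓕 (g ⋆[ContinuousLinearMap.mul ℂ ℂ] f)) (g := 𝓕 f) (Eventually.of_forall fun ξ => ?_) 2
  · simpa [ENNReal.smul_def] using hpt
  rw [Real.fourier_mul_convolution_eq hg hfi, ← NNReal.coe_le_coe]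
  push_cast
  rw [norm_mul]
  gcongr
  exact hM ξ

/-- Test functions `u n → f` in `L²` have `g ⋆ u n → g ⋆ f` pointwise because `g` is in `L²`, and
Fatou's lemma passes the bound to the limit. -/
theorem eLpNorm_convolution_le_of_hasCompactSupport {g f : ℝ → ℂ} {M : ℝ≥0} (hg : MemLp g 2)
    (hgc : HasCompactSupport g) (hM : ∀ ξ, ‖𝓕 g ξ‖ ≤ M) (hf : MemLp f 2) :
    MemLp (g ⋆[ContinuousLinearMap.mul ℂ ℂ] f) 2 ∧
      eLpNorm (g ⋆[ContinuousLinearMap.mul ℂ ℂ] f) 2 volume ≤ M * eLpNorm f 2 volume := by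
  have hgi : Integrable g := by
    rw [← integrableOn_iff_integrable_of_support_subset (subset_tsupport g)]
    have : IsFiniteMeasure (volume.restrict (tsupport g)) :=
      ⟨by simpa using hgc.isCompact.measure_lt_top⟩
    exact (hg.restrict _).integrable (by norm_num)
  choose u huc hu hfu using fun n : ℕ =>
    hf.exist_eLpNorm_sub_le (by norm_num) (by norm_num) (ε := 1 / ((n : ℝ) + 1)) (by positivity)
  have hu2 : ∀ n, MemLp (u n) 2 volume := fun n =>
    (hu n).continuous.memLp_of_hasCompactSupport (huc n)
  have h0 : Tendsto (fun n => eLpNorm (f - u n) 2 volume) atTop (𝓝 0) := by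
    refine tendsto_of_tendsto_of_tendsto_of_le_of_le tendsto_const_nhds ?_
      (fun _ => zero_le) hfu
    have := ENNReal.tendsto_ofReal tendsto_one_div_add_atTop_nhds_zero_nat
    simpa using this
  have hlim : ∀ x, Tendsto (fun n => (g ⋆[ContinuousLinearMap.mul ℂ ℂ] u n) x) atTop
      (𝓝 ((g ⋆[ContinuousLinearMap.mul ℂ ℂ] f) x)) := by
    intro x
    rw [tendsto_iff_edist_tendsto_0]
    have hb : Tendsto (fun n => eLpNorm g 2 volume * eLpNorm (f - u n) 2 volume) atTop (𝓝 0) := by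
      simpa using ENNReal.Tendsto.const_mul h0 (Or.inr hg.2.ne)
    refine tendsto_of_tendsto_of_tendsto_of_le_of_le tendsto_const_nhds hb
      (fun _ => zero_le) fun n => ?_
    have hd := ConvolutionExistsAt.distrib_add (convolutionExists_of_memLp_two hg (hu2 n) x)
      (convolutionExists_of_memLp_two hg (hf.sub (hu2 n)) x)
    rw [add_sub_cancel] at hd
    rw [edist_comm, edist_eq_enorm_sub, hd, add_sub_cancel_left]
    exact enorm_convolution_le hg (hf.sub (hu2 n)) x
  have hm : ∀ n, AEStronglyMeasurable (g ⋆[ContinuousLinearMap.mul ℂ ℂ] u n) volume := fun n =>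
    ((huc n).continuous_convolution_right (ContinuousLinearMap.mul ℂ ℂ) hgi.locallyIntegrable
      (hu n).continuous).aestronglyMeasurable
  have hle : eLpNorm (g ⋆[ContinuousLinearMap.mul ℂ ℂ] f) 2 volume ≤ M * eLpNorm f 2 volume := by
    refine ENNReal.le_of_forall_pos_le_add fun ε hε _ => ?_
    refine Lp.eLpNorm_le_of_ae_tendsto (u := atTop) ?_ hm (Eventually.of_forall hlim)
    have hb : Tendsto (fun n => (M : ℝ≥0∞) * eLpNorm (f - u n) 2 volume) atTop (𝓝 0) := by
      simpa using ENNReal.Tendsto.const_mul h0 (Or.inr ENNReal.coe_ne_top)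
    filter_upwards [hb.eventually_lt_const (u := (ε : ℝ≥0∞)) (by exact_mod_cast hε)] with n hn
    calc eLpNorm (g ⋆[ContinuousLinearMap.mul ℂ ℂ] u n) 2 volume
        ≤ M * eLpNorm (u n) 2 volume :=
          eLpNorm_convolution_le_of_contDiff hgi hgc hM (huc n) (hu n)
      _ ≤ M * (eLpNorm f 2 volume + eLpNorm (f - u n) 2 volume) := by
          gcongr
          conv_lhs => rw [show u n = f - (f - u n) by simp]
          exact eLpNorm_sub_le hf.1 (hf.sub (hu2 n)).1 (by norm_num)
      _ ≤ M * eLpNorm f 2 volume + ε := by rw [mul_add]; gcongr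
  refine ⟨⟨aestronglyMeasurable_of_tendsto_ae atTop hm (Eventually.of_forall hlim), ?_⟩, hle⟩
  exact hle.trans_lt (ENNReal.mul_lt_top ENNReal.coe_lt_top hf.2)

/-- A square-integrable kernel all of whose truncations `1_{[-n, n]} g` have Fourier transforms
bounded by `M` convolves `L²(ℝ)` to itself with norm at most `M`. -/
theorem eLpNorm_convolution_le {g f : ℝ → ℂ} {M : ℝ≥0} (hg : MemLp g 2)
    (hM : ∀ (n : ℕ) (ξ : ℝ), ‖𝓕 ((Set.Icc (-n : ℝ) n).indicator g) ξ‖ ≤ M) (hf : MemLp f 2) :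
    MemLp (g ⋆[ContinuousLinearMap.mul ℂ ℂ] f) 2 ∧
      eLpNorm (g ⋆[ContinuousLinearMap.mul ℂ ℂ] f) 2 volume ≤ M * eLpNorm f 2 volume := by
  have key := fun n : ℕ => eLpNorm_convolution_le_of_hasCompactSupport
    (hg.indicator (measurableSet_Icc (a := (-n : ℝ)) (b := n)))
    (HasCompactSupport.intro isCompact_Icc fun x hx => Set.indicator_of_notMem hx g) (hM n) hf
  have hlim : ∀ x, Tendsto (fun n : ℕ => ((Set.Icc (-n : ℝ) n).indicator g
      ⋆[ContinuousLinearMap.mul ℂ ℂ] f) x) atTop (𝓝 ((g ⋆[ContinuousLinearMap.mul ℂ ℂ] f) x)) := by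
    intro x
    have hx := convolutionExists_of_memLp_two hg hf x
    refine tendsto_integral_of_dominated_convergence
      (fun t => ‖ContinuousLinearMap.mul ℂ ℂ (g t) (f (x - t))‖) (fun n => ?_) hx.norm
      (fun n => Eventually.of_forall fun t => ?_) (Eventually.of_forall fun t => ?_)
    · exact (convolutionExists_of_memLp_two
        (hg.indicator (measurableSet_Icc (a := (-n : ℝ)) (b := n))) hf x).1
    · simp only [ContinuousLinearMap.mul_apply', norm_mul]
      gcongr
      exact norm_indicator_le_norm_self _ _
    · refine tendsto_const_nhds.congr' ?_
      filter_upwards [eventually_ge_atTop ⌈|t|⌉₊] with n hn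
      rw [Set.indicator_of_mem]
      exact abs_le.1 ((Nat.le_ceil _).trans (by exact_mod_cast hn))
  have hle : eLpNorm (g ⋆[ContinuousLinearMap.mul ℂ ℂ] f) 2 volume ≤ M * eLpNorm f 2 volume :=
    Lp.eLpNorm_le_of_ae_tendsto (u := atTop) (Eventually.of_forall fun n => (key n).2)
      (fun n => (key n).1.1) (Eventually.of_forall hlim)
  exact ⟨⟨aestronglyMeasurable_of_tendsto_ae atTop (fun n => (key n).1.1)
    (Eventually.of_forall hlim), hle.trans_lt (ENNReal.mul_lt_top ENNReal.coe_lt_top hf.2)⟩, hle⟩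

end Multiplier

/-! ### Calderón-Zygmund kernels on the real line -/

section RealKernel

open FourierTransform Convolution Filter Topology

/-- A 1-dimensional Calderón-Zygmund kernel for convolution on `ℝ`, with explicit constants. The
value at `0` is irrelevant. -/
structure IsRealCZKernel (k : ℝ → ℝ) (B β : ℝ) : Prop where
  continuousOn : ContinuousOn k {0}ᶜ
  B_pos : 0 < B
  β_pos : 0 < β
  size : ∀ t, t ≠ 0 → |k t| ≤ B / |t|
  holder : ∀ t u, t ≠ 0 → |t - u| ≤ |t| / 2 → |k t - k u| ≤ B * (|t - u| ^ β / |t| ^ (1 + β))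

/-- The truncations at level `ε > 0` of convolution with `k` are bounded on `L²(ℝ)` with norm at
most `C`. -/
def BoundedTruncations (k : ℝ → ℝ) (C : ℝ≥0) : Prop :=
  ∀ ε : ℝ, 0 < ε → ∀ f : ℝ → ℝ, MemLp f 2 →
    MemLp (fun x => ∫ y in {y | ε < |x - y|}, k (x - y) * f y) 2 ∧
      eLpNorm (fun x => ∫ y in {y | ε < |x - y|}, k (x - y) * f y) 2 volume ≤
        C * eLpNorm f 2 volume

/-- The two-sided shell `{r < |t| ≤ R}` in `ℝ`. -/
def shell (r R : ℝ) : Set ℝ := {t | r < |t| ∧ |t| ≤ R}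

theorem measurableSet_shell (r R : ℝ) : MeasurableSet (shell r R) :=
  (measurableSet_lt measurable_const measurable_norm).inter
    (measurableSet_le measurable_norm measurable_const)

theorem shell_subset_Icc (r R : ℝ) : shell r R ⊆ Set.Icc (-R) R := fun _ ht => abs_le.1 ht.2

theorem volume_shell_lt_top (r R : ℝ) : volume (shell r R) < ⊤ :=
  (measure_mono (shell_subset_Icc r R)).trans_lt measure_Icc_lt_top

theorem volume_real_shell_le {r R : ℝ} (h : r ≤ R) : volume.real (shell r R) ≤ 2 * (R - r) := by
  have hsub : shell r R ⊆ Set.Ioc r R ∪ Set.Ico (-R) (-r) := by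
    rintro t ⟨h1, h2⟩
    rcases abs_cases t with ⟨h3, h4⟩ | ⟨h3, h4⟩
    · exact Or.inl ⟨by linarith, by linarith⟩
    · exact Or.inr ⟨by linarith, by linarith⟩
  calc volume.real (shell r R) ≤ volume.real (Set.Ioc r R ∪ Set.Ico (-R) (-r)) :=
        measureReal_mono hsub (measure_union_lt_top measure_Ioc_lt_top measure_Ico_lt_top).ne
    _ ≤ volume.real (Set.Ioc r R) + volume.real (Set.Ico (-R) (-r)) := measureReal_union_le _ _
    _ = 2 * (R - r) := by
        rw [Real.volume_real_Ioc_of_le h, Real.volume_real_Ico_of_le (by linarith)]; ring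

theorem shell_union {r a R : ℝ} (hr : r ≤ a) (hR : a ≤ R) :
    shell r a ∪ shell a R = shell r R := by
  ext t
  simp only [shell, Set.mem_union, Set.mem_ofPred_eq]
  constructor
  · rintro (⟨h1, h2⟩ | ⟨h1, h2⟩) <;> constructor <;> linarith
  · rintro ⟨h1, h2⟩
    rcases le_or_gt |t| a with h | h
    exacts [Or.inl ⟨h1, h⟩, Or.inr ⟨h, h2⟩]

theorem shell_disjoint (r a R : ℝ) : Disjoint (shell r a) (shell a R) :=
  Set.disjoint_left.2 fun _ h1 h2 => absurd h1.2 (not_le.2 h2.1)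

theorem measurableSet_lt_abs (r : ℝ) : MeasurableSet {t : ℝ | r < |t|} :=
  measurableSet_lt measurable_const measurable_norm

theorem integrableOn_abs_rpow {p r : ℝ} (hp : p < -1) (hr : 0 < r) :
    IntegrableOn (fun t : ℝ => |t| ^ p) {t | r < |t|} := by
  have hset : {t : ℝ | r < |t|} = Set.Ioi r ∪ Set.Iio (-r) := by
    ext t
    simp [lt_abs, lt_neg]
  have hIoi : IntegrableOn (fun t : ℝ => |t| ^ p) (Set.Ioi r) :=
    (integrableOn_Ioi_rpow_of_lt hp hr).congr_fun
      (fun t ht => by simp only [abs_of_pos (hr.trans ht)]) measurableSet_Ioi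
  rw [hset]
  refine hIoi.union ?_
  have := hIoi.comp_neg
  simpa using this

theorem integral_abs_rpow {p r : ℝ} (hp : p < -1) (hr : 0 < r) :
    ∫ t in {t : ℝ | r < |t|}, |t| ^ p = 2 * (-r ^ (p + 1) / (p + 1)) := by
  rw [← integral_indicator (measurableSet_lt_abs r)]
  have : ∀ t : ℝ, {t : ℝ | r < |t|}.indicator (fun t => |t| ^ p) t
      = (Set.Ioi r).indicator (fun t => t ^ p) |t| := by
    intro t
    simp [Set.indicator_apply]
  simp_rw [this]
  rw [integral_comp_abs (f := (Set.Ioi r).indicator (fun t => t ^ p)),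
    setIntegral_indicator measurableSet_Ioi,
    Set.inter_eq_right.2 (Set.Ioi_subset_Ioi hr.le), integral_Ioi_rpow_of_lt hp hr]

namespace IsRealCZKernel

variable {k : ℝ → ℝ} {B β : ℝ} (hk : IsRealCZKernel k B β)
include hk

theorem measurable : Measurable k := measurable_of_continuousOn_compl_singleton 0 hk.continuousOn

theorem abs_le_of_lt {r t : ℝ} (hr : 0 < r) (ht : r < |t|) : |k t| ≤ B / r :=
  (hk.size t (abs_pos.1 (hr.trans ht))).trans
    (div_le_div_of_nonneg_left hk.B_pos.le hr ht.le)

theorem integrableOn_shell {r : ℝ} (hr : 0 < r) (R : ℝ) : IntegrableOn k (shell r R) :=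
  Measure.integrableOn_of_bounded (volume_shell_lt_top r R).ne
    hk.measurable.aestronglyMeasurable (M := B / r)
    ((ae_restrict_iff' (measurableSet_shell r R)).2
      (Eventually.of_forall fun _ ht => hk.abs_le_of_lt hr ht.1))

theorem integrable_shell {r : ℝ} (hr : 0 < r) (R : ℝ) : Integrable ((shell r R).indicator k) :=
  (hk.integrableOn_shell hr R).integrable_indicator (measurableSet_shell r R)

/-- Translating the truncated kernel by a small `h` costs the Hölder bound where both points stay
in the shell, and the size bound in the thin shells of width `|h|` along its boundary. -/
theorem abs_shell_sub_translate_le {r h : ℝ} (R : ℝ) (hr : 0 < r) (hh : |h| ≤ r / 2) (t : ℝ) :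
    |(shell r R).indicator k t - (shell r R).indicator k (t + h)| ≤
      {t : ℝ | r < |t|}.indicator (fun t => B * |h| ^ β * |t| ^ (-(1 + β))) t +
      ((shell r (r + |h|)).indicator (fun _ => B / r) t +
        (shell (R - |h|) R).indicator (fun _ => B / r) t) +
      ((shell r (r + |h|)).indicator (fun _ => B / r) (t + h) +
        (shell (R - |h|) R).indicator (fun _ => B / r) (t + h)) := by
  have hB := hk.B_pos
  have hBr : 0 ≤ B / r := by positivity
  have n0 : 0 ≤ {t : ℝ | r < |t|}.indicator (fun t => B * |h| ^ β * |t| ^ (-(1 + β))) t :=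
    Set.indicator_nonneg (fun t _ => by positivity) t
  have nn : ∀ a b u, 0 ≤ (shell a b).indicator (fun _ => B / r) u := fun a b u =>
    Set.indicator_nonneg (fun _ _ => hBr) u
  have hbdry : ∀ u v, u ∈ shell r R → v ∉ shell r R → |u - v| = |h| → |k u| ≤
      (shell r (r + |h|)).indicator (fun _ => B / r) u +
        (shell (R - |h|) R).indicator (fun _ => B / r) u := by
    intro u v hu hv huv
    have h1 := hk.abs_le_of_lt hr hu.1
    have h2 := abs_sub_abs_le_abs_sub u v
    have h3 := abs_sub_abs_le_abs_sub v u
    rw [abs_sub_comm v u] at h3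
    by_cases hvr : r < |v|
    · have hvR : R < |v| := not_le.1 fun h => hv ⟨hvr, h⟩
      rw [Set.indicator_of_mem (s := shell (R - |h|) R) ⟨by linarith, hu.2⟩]
      linarith [nn r (r + |h|) u]
    · rw [Set.indicator_of_mem (s := shell r (r + |h|)) ⟨hu.1, by linarith⟩]
      linarith [nn (R - |h|) R u]
  have hth : |t - (t + h)| = |h| := by rw [sub_add_cancel_left, abs_neg]
  have m1 := nn r (r + |h|) t
  have m2 := nn (R - |h|) R t
  have m3 := nn r (r + |h|) (t + h)
  have m4 := nn (R - |h|) R (t + h)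
  by_cases h1 : t ∈ shell r R <;> by_cases h2 : t + h ∈ shell r R
  · rw [Set.indicator_of_mem h1, Set.indicator_of_mem h2]
    have h3 := hk.holder t (t + h) (abs_pos.1 (hr.trans h1.1)) (by rw [hth]; linarith [h1.1])
    rw [hth] at h3
    rw [Set.indicator_of_mem (s := {t : ℝ | r < |t|}) h1.1, Real.rpow_neg (abs_nonneg t),
      mul_assoc, ← div_eq_mul_inv]
    linarith
  · rw [Set.indicator_of_mem h1, Set.indicator_of_notMem h2, sub_zero]
    linarith [hbdry t (t + h) h1 h2 hth]
  · rw [Set.indicator_of_notMem h1, Set.indicator_of_mem h2, zero_sub, abs_neg]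
    linarith [hbdry (t + h) t h2 h1 (by rw [abs_sub_comm, hth])]
  · rw [Set.indicator_of_notMem h1, Set.indicator_of_notMem h2, sub_zero, abs_zero]
    linarith

theorem integral_abs_shell_sub_translate_le {r h R : ℝ} (hr : 0 < r) (hh : |h| ≤ r / 2) :
    ∫ t, |(shell r R).indicator k t - (shell r R).indicator k (t + h)| ≤ 2 * (B / β) + 4 * B := by
  have hB := hk.B_pos
  have hβ := hk.β_pos
  have i0 : Integrable ({t : ℝ | r < |t|}.indicator
      (fun t => B * |h| ^ β * |t| ^ (-(1 + β)))) :=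
    IntegrableOn.integrable_indicator
      ((integrableOn_abs_rpow (p := -(1 + β)) (by linarith) hr).const_mul _)
      (measurableSet_lt_abs r)
  have ii : ∀ a b, Integrable ((shell a b).indicator (fun _ => B / r)) := fun a b =>
    (integrableOn_const (volume_shell_lt_top a b).ne).integrable_indicator (measurableSet_shell a b)
  have v0 : ∫ t, {t : ℝ | r < |t|}.indicator (fun t => B * |h| ^ β * |t| ^ (-(1 + β))) t
      ≤ 2 * (B / β) := by
    rw [integral_indicator (measurableSet_lt_abs r),
      integral_const_mul, integral_abs_rpow (by linarith) hr]
    have e : -r ^ (-(1 + β) + 1) / (-(1 + β) + 1) = (r ^ β)⁻¹ / β := by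
      rw [show -(1 + β) + 1 = -β by ring, Real.rpow_neg hr.le, neg_div_neg_eq]
    rw [e]
    have hq : |h| ^ β * (r ^ β)⁻¹ ≤ 1 := by
      rw [← div_eq_mul_inv, ← Real.div_rpow (abs_nonneg h) hr.le]
      exact Real.rpow_le_one (by positivity) ((div_le_one hr).2 (by linarith)) hβ.le
    calc B * |h| ^ β * (2 * ((r ^ β)⁻¹ / β)) = 2 * (B / β) * (|h| ^ β * (r ^ β)⁻¹) := by ring
      _ ≤ 2 * (B / β) * 1 := by gcongr
      _ = 2 * (B / β) := mul_one _
  have vv : ∀ a b, a ≤ b → b - a = |h| →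
      ∫ t, (shell a b).indicator (fun _ => B / r) t ≤ B := by
    intro a b hab hba
    rw [integral_indicator_const _ (measurableSet_shell a b), smul_eq_mul]
    have := volume_real_shell_le hab
    calc volume.real (shell a b) * (B / r) ≤ r * (B / r) := by gcongr; linarith
      _ = B := by field_simp
  have w1 := vv r (r + |h|) (by linarith [abs_nonneg h]) (by ring)
  have w2 := vv (R - |h|) R (by linarith [abs_nonneg h]) (by ring)
  have iS := (ii r (r + |h|)).add (ii (R - |h|) R)
  have wS := integral_add (ii r (r + |h|)) (ii (R - |h|) R)
  have wT := integral_add_right_eq_self (μ := volume) (fun t =>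
    (shell r (r + |h|)).indicator (fun _ => B / r) t +
        (shell (R - |h|) R).indicator (fun _ => B / r) t) h
  calc ∫ t, |(shell r R).indicator k t - (shell r R).indicator k (t + h)|
      ≤ ∫ t, ({t : ℝ | r < |t|}.indicator (fun t => B * |h| ^ β * |t| ^ (-(1 + β))) t +
      ((shell r (r + |h|)).indicator (fun _ => B / r) t +
        (shell (R - |h|) R).indicator (fun _ => B / r) t) +
      ((shell r (r + |h|)).indicator (fun _ => B / r) (t + h) +
        (shell (R - |h|) R).indicator (fun _ => B / r) (t + h))) :=
        integral_mono
          ((hk.integrable_shell hr R).sub ((hk.integrable_shell hr R).comp_add_right h)).abs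
          ((i0.add iS).add (iS.comp_add_right h))
          (hk.abs_shell_sub_translate_le R hr hh)
    _ ≤ 2 * (B / β) + 4 * B := by
        have e1 := integral_add (i0.add iS) (iS.comp_add_right h)
        have e2 := integral_add i0 iS
        simp only [Pi.add_apply] at e1 e2
        rw [e1, e2, wT, wS]
        linarith

/-- High frequencies: the shift by half a period changes the sign of the character, so that the
Fourier transform is controlled by the `L¹` modulus of continuity of the truncated kernel. -/
theorem norm_fourier_shell_le_of_one_le {r R ξ : ℝ} (hr : 0 < r) (hξ : 1 ≤ r * |ξ|) :
    ‖𝓕 (fun t => (((shell r R).indicator k t : ℝ) : ℂ)) ξ‖ ≤ B / β + 2 * B := by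
  have hξ0 : ξ ≠ 0 := by rintro rfl; norm_num at hξ
  have hξp : 0 < |ξ| := abs_pos.2 hξ0
  set h : ℝ := (1 / (2 * ‖ξ‖ ^ 2) : ℝ) • ξ with hdef
  have hh : |h| ≤ r / 2 := by
    rw [hdef, smul_eq_mul, abs_mul, Real.norm_eq_abs, abs_of_pos (by positivity)]
    rw [show 1 / (2 * |ξ| ^ 2) * |ξ| = 1 / |ξ| / 2 by field_simp]
    gcongr
    rwa [div_le_iff₀ hξp]
  rw [Real.fourier_eq, fourierIntegral_eq_half_sub_half_period_translate hξ0
    (hk.integrable_shell hr R).ofReal, norm_smul]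
  have h1 : ‖∫ v : ℝ, Real.fourierChar (-inner ℝ v ξ) •
      ((((shell r R).indicator k v : ℝ) : ℂ) - (((shell r R).indicator k (v + h) : ℝ) : ℂ))‖ ≤
      2 * (B / β) + 4 * B := by
    refine (norm_integral_le_integral_norm _).trans (le_trans (le_of_eq ?_)
      (hk.integral_abs_shell_sub_translate_le (R := R) hr hh))
    refine integral_congr_ae (Eventually.of_forall fun t => ?_)
    simp only [Circle.norm_smul]
    rw [← Complex.ofReal_sub, Complex.norm_real, Real.norm_eq_abs]
  have h2 : ‖(1 / 2 : ℂ)‖ = 1 / 2 := by norm_num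
  rw [h2]
  change 1 / 2 * ‖∫ v : ℝ, Real.fourierChar (-inner ℝ v ξ) •
      ((((shell r R).indicator k v : ℝ) : ℂ) - (((shell r R).indicator k (v + h) : ℝ) : ℂ))‖ ≤ _
  linarith

/-- Low frequencies: the character is close to `1` on the shell, where the kernel has bounded
integral. -/
theorem norm_fourier_shell_le_of_le_one {r R ξ A : ℝ} (hr : 0 < r) (hR : 0 ≤ R)
    (hξ : R * |ξ| ≤ 1) (hA : |∫ t in shell r R, k t| ≤ A) :
    ‖𝓕 (fun t => (((shell r R).indicator k t : ℝ) : ℂ)) ξ‖ ≤ A + 4 * Real.pi * B := by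
  have hB := hk.B_pos
  have hi := (hk.integrable_shell hr R).ofReal (𝕜 := ℂ)
  have hfi := (Real.fourierIntegral_convergent_iff ξ).2 hi
  have hsplit : 𝓕 (fun t => (((shell r R).indicator k t : ℝ) : ℂ)) ξ =
      (∫ t in shell r R, ((Real.fourierChar (-inner ℝ t ξ) : ℂ) - 1) * (k t : ℂ)) +
        ((∫ t in shell r R, k t : ℝ) : ℂ) := by
    rw [← integral_indicator (measurableSet_shell r R), ← integral_indicator
      (measurableSet_shell r R), ← integral_complex_ofReal, Real.fourier_eq]
    have : (shell r R).indicator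
        (fun t => ((Real.fourierChar (-inner ℝ t ξ) : ℂ) - 1) * (k t : ℂ)) =
        fun t => Real.fourierChar (-inner ℝ t ξ) • (((shell r R).indicator k t : ℝ) : ℂ) -
          (((shell r R).indicator k t : ℝ) : ℂ) := by
      ext t
      by_cases ht : t ∈ shell r R
      · simp [ht, Circle.smul_def, sub_mul]
      · simp [ht]
    rw [this]
    exact sub_eq_iff_eq_add.1 (integral_sub hfi hi).symm
  rw [hsplit]
  have h1 : ‖∫ t in shell r R, ((Real.fourierChar (-inner ℝ t ξ) : ℂ) - 1) * (k t : ℂ)‖ ≤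
      2 * Real.pi * |ξ| * B * volume.real (shell r R) := by
    refine norm_setIntegral_le_of_norm_le_const (volume_shell_lt_top r R) fun t ht => ?_
    have ht0 : 0 < |t| := hr.trans ht.1
    have hchar : ‖(Real.fourierChar (-inner ℝ t ξ) : ℂ) - 1‖ ≤ 2 * Real.pi * (|t| * |ξ|) := by
      rw [Real.fourierChar_apply, mul_comm _ Complex.I]
      refine Real.norm_exp_I_mul_ofReal_sub_one_le.trans_eq ?_
      simp [abs_of_pos Real.pi_pos, mul_comm]
    calc ‖((Real.fourierChar (-inner ℝ t ξ) : ℂ) - 1) * (k t : ℂ)‖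
        ≤ 2 * Real.pi * (|t| * |ξ|) * (B / |t|) := by
          rw [norm_mul, Complex.norm_real]
          exact mul_le_mul hchar (hk.size t (abs_pos.1 ht0)) (norm_nonneg _) (by positivity)
      _ = 2 * Real.pi * |ξ| * B := by field_simp
  have hv : volume.real (shell r R) ≤ 2 * R := by
    refine (measureReal_mono (shell_subset_Icc r R) measure_Icc_lt_top.ne).trans_eq ?_
    rw [Real.volume_real_Icc_of_le (by linarith)]; ring
  refine (norm_add_le _ _).trans ?_
  rw [Complex.norm_real, Real.norm_eq_abs]
  have h2 : 2 * Real.pi * |ξ| * B * volume.real (shell r R) ≤ 4 * Real.pi * B := by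
    calc 2 * Real.pi * |ξ| * B * volume.real (shell r R) ≤ 2 * Real.pi * |ξ| * B * (2 * R) := by
          gcongr
      _ = 4 * Real.pi * B * (R * |ξ|) := by ring
      _ ≤ 4 * Real.pi * B * 1 := by gcongr
      _ = 4 * Real.pi * B := mul_one _
  linarith

theorem norm_fourier_shell_le {A : ℝ} (hA : ∀ r R, 0 < r → r < R → |∫ t in shell r R, k t| ≤ A)
    {r : ℝ} (hr : 0 < r) (R ξ : ℝ) :
    ‖𝓕 (fun t => (((shell r R).indicator k t : ℝ) : ℂ)) ξ‖ ≤
      A + 4 * Real.pi * B + (B / β + 2 * B) := by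
  have hB := hk.B_pos
  have hβ := hk.β_pos
  have hA0 : 0 ≤ A := (abs_nonneg _).trans (hA 1 2 one_pos one_lt_two)
  have hp : 0 ≤ B / β + 2 * B := by positivity
  have hq : 0 ≤ A + 4 * Real.pi * B := by positivity
  rcases le_or_gt 1 (r * |ξ|) with h1 | h1
  · linarith [hk.norm_fourier_shell_le_of_one_le (R := R) hr h1]
  rcases le_or_gt R r with hRr | hRr
  · have : shell r R = ∅ := Set.eq_empty_of_forall_notMem fun t ht =>
      absurd (ht.1.trans_le ht.2) (not_lt.2 hRr)
    have h0 : 𝓕 (fun t : ℝ => (((shell r R).indicator k t : ℝ) : ℂ)) ξ = 0 := by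
      rw [Real.fourier_eq, this]; simp
    rw [h0, norm_zero]; positivity
  rcases le_or_gt (R * |ξ|) 1 with h2 | h2
  · linarith [hk.norm_fourier_shell_le_of_le_one hr (hr.trans hRr).le h2 (hA r R hr hRr)]
  have hξ : 0 < |ξ| := by
    by_contra h
    have : |ξ| = 0 := le_antisymm (not_lt.1 h) (abs_nonneg _)
    rw [this] at h2; norm_num at h2
  have ha : |ξ|⁻¹ * |ξ| = 1 := inv_mul_cancel₀ hξ.ne'
  have hra : r < |ξ|⁻¹ := by rwa [lt_inv_comm₀ hr hξ, ← one_div, lt_div_iff₀ hr, mul_comm]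
  have haR : |ξ|⁻¹ ≤ R := by rw [inv_le_comm₀ hξ (hr.trans hRr), inv_eq_one_div,
    div_le_iff₀ (hr.trans hRr)]; linarith
  -- The scale `1 / |ξ|` separates the oscillating range from the cancelling one.
  have hsum : (fun t => (((shell r R).indicator k t : ℝ) : ℂ)) =
      (fun t => (((shell r |ξ|⁻¹).indicator k t : ℝ) : ℂ)) +
        fun t => (((shell |ξ|⁻¹ R).indicator k t : ℝ) : ℂ) := by
    rw [← shell_union hra.le haR, Set.indicator_union_of_disjoint (shell_disjoint _ _ _)]
    ext t
    simp
  have hadd : 𝓕 (fun t => (((shell r R).indicator k t : ℝ) : ℂ)) ξ =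
      𝓕 (fun t => (((shell r |ξ|⁻¹).indicator k t : ℝ) : ℂ)) ξ +
        𝓕 (fun t => (((shell |ξ|⁻¹ R).indicator k t : ℝ) : ℂ)) ξ := by
    rw [hsum]
    simp only [Real.fourier_eq, Pi.add_apply, smul_add]
    exact integral_add
      ((Real.fourierIntegral_convergent_iff ξ).2 (hk.integrable_shell hr _).ofReal)
      ((Real.fourierIntegral_convergent_iff ξ).2 (hk.integrable_shell (hr.trans hra) R).ofReal)
  rw [hadd]
  exact (norm_add_le _ _).trans (add_le_add
    (hk.norm_fourier_shell_le_of_le_one hr (by positivity) ha.le (hA r _ hr hra))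
    (hk.norm_fourier_shell_le_of_one_le (hr.trans hra) ha.ge))

theorem memLp_two_tail {ε : ℝ} (hε : 0 < ε) : MemLp ({t : ℝ | ε < |t|}.indicator k) 2 := by
  have hS := measurableSet_lt_abs ε
  rw [memLp_two_iff_integrable_sq (hk.measurable.indicator hS).aestronglyMeasurable]
  refine (IntegrableOn.integrable_indicator ((integrableOn_abs_rpow (p := -2) (by norm_num)
    hε).const_mul (B ^ 2)) hS).mono'
    ((hk.measurable.indicator hS).pow_const 2).aestronglyMeasurable
    (Eventually.of_forall fun t => ?_)
  by_cases ht : t ∈ {t : ℝ | ε < |t|}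
  · have ht0 : 0 < |t| := hε.trans ht
    simp only [Set.indicator_of_mem ht]
    rw [norm_pow, Real.norm_eq_abs, Real.rpow_neg ht0.le, ← div_eq_mul_inv]
    have := hk.size t (abs_pos.1 ht0)
    calc |k t| ^ 2 ≤ (B / |t|) ^ 2 := by gcongr
      _ = B ^ 2 / |t| ^ (2 : ℝ) := by rw [div_pow]; norm_num
  · simp [Set.indicator_of_notMem ht]

/-- If the integrals of the kernel over shells are bounded, then its truncations define uniformly
bounded operators on `L²(ℝ)`. -/
theorem boundedTruncations {A : ℝ} {M : ℝ≥0}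
    (hA : ∀ r R, 0 < r → r < R → |∫ t in shell r R, k t| ≤ A)
    (hM : A + 4 * Real.pi * B + (B / β + 2 * B) ≤ M) : BoundedTruncations k M := by
  intro ε hε f hf
  set g : ℝ → ℂ := fun t => (({t : ℝ | ε < |t|}.indicator k t : ℝ) : ℂ) with hg
  have hconv : (fun x => ((∫ y in {y | ε < |x - y|}, k (x - y) * f y : ℝ) : ℂ)) =
      (g ⋆[ContinuousLinearMap.mul ℂ ℂ] fun y => (f y : ℂ)) := by
    ext x
    have hS : MeasurableSet {y : ℝ | ε < |x - y|} :=
      measurableSet_lt measurable_const (measurable_const.sub measurable_id).norm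
    rw [convolution_def, ← integral_sub_left_eq_self _ volume x, ← integral_complex_ofReal,
      ← integral_indicator hS]
    congr 1
    ext y
    by_cases hy : ε < |x - y| <;> simp [hg, hy, Set.indicator_apply]
  have htrunc : ∀ n : ℕ, (Set.Icc (-n : ℝ) n).indicator g =
      fun t => (((shell ε n).indicator k t : ℝ) : ℂ) := by
    intro n
    ext t
    by_cases h1 : ε < |t| <;> by_cases h2 : |t| ≤ n <;>
      simp [hg, shell, Set.indicator_apply, h1, h2, ← abs_le]
  have hcast : ∀ u : ℝ → ℝ, eLpNorm (fun x => (u x : ℂ)) 2 volume = eLpNorm u 2 volume :=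
    fun u => eLpNorm_congr_norm_ae (Eventually.of_forall fun x => Complex.norm_real _)
  have main := eLpNorm_convolution_le (hk.memLp_two_tail hε).ofReal (M := M)
    (f := fun y => (f y : ℂ)) (fun n ξ => by
      have := hk.norm_fourier_shell_le hA hε n ξ
      rw [← htrunc] at this
      exact this.trans hM) hf.ofReal
  have main' := hconv ▸ main
  rw [hcast, hcast] at main'
  exact ⟨main'.1.re, main'.2⟩

end IsRealCZKernel

end RealKernel

namespace IsRealCZKernel

open Filter

variable {k : ℝ → ℝ} {B β : ℝ} (hk : IsRealCZKernel k B β)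
include hk

/-! ### Cancellation of the kernel on the line -/

/-- Replacing the sharp cutoff `1_{|t| ≤ ρ}` by `F (t / ρ)` only affects `ρ / 2 ≤ |t| ≤ 2 ρ`, where
`|k| ≤ 2 B / ρ`. -/
theorem cutoff_sub_indicator_bounds {F : ℝ → ℝ} (hFm : Measurable F) (hF0 : ∀ t, 0 ≤ F t)
    (hF1 : ∀ t, F t ≤ 1) (hin : ∀ t, |t| < 1 / 2 → F t = 1) (hout : ∀ t, 2 ≤ |t| → F t = 0)
    {ρ : ℝ} (hρ : 0 < ρ) :
    Integrable (fun t => (F (t / ρ) - {t : ℝ | |t| ≤ ρ}.indicator 1 t) * k t) ∧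
      |∫ t, (F (t / ρ) - {t : ℝ | |t| ≤ ρ}.indicator 1 t) * k t| ≤ 8 * B := by
  have hB := hk.B_pos
  have hm : MeasurableSet {t : ℝ | |t| ≤ ρ} := measurableSet_le measurable_norm measurable_const
  have habs : ∀ t, |t / ρ| = |t| / ρ := fun t => by rw [abs_div, abs_of_pos hρ]
  have hoff : ∀ t, t ∉ Set.Icc (-(2 * ρ)) (2 * ρ) →
      (F (t / ρ) - {t : ℝ | |t| ≤ ρ}.indicator 1 t) * k t = 0 := by
    intro t ht
    rw [Set.mem_Icc, ← abs_le, not_le] at ht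
    rw [hout _ (by rw [habs, le_div_iff₀ hρ]; exact ht.le), Set.indicator_of_notMem, sub_zero,
      zero_mul]
    exact not_le.2 (by linarith : ρ < |t|)
  have hbd : ∀ t, ‖(F (t / ρ) - {t : ℝ | |t| ≤ ρ}.indicator 1 t) * k t‖ ≤ 2 * B / ρ := by
    intro t
    rcases lt_or_ge |t| (ρ / 2) with ht | ht
    · rw [hin _ (by rw [habs, div_lt_iff₀ hρ]; linarith), Set.indicator_of_mem]
      · simp only [Pi.one_apply, sub_self, zero_mul, norm_zero]; positivity
      · exact (by linarith : |t| ≤ ρ)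
    · have ht0 : 0 < |t| := by linarith
      have h1 : |F (t / ρ) - {t : ℝ | |t| ≤ ρ}.indicator 1 t| ≤ 1 := by
        have a := hF0 (t / ρ)
        have b := hF1 (t / ρ)
        rw [abs_le]
        by_cases h : |t| ≤ ρ
        · rw [Set.indicator_of_mem (s := {t : ℝ | |t| ≤ ρ}) h, Pi.one_apply]
          constructor <;> linarith
        · rw [Set.indicator_of_notMem (s := {t : ℝ | |t| ≤ ρ}) h]
          constructor <;> linarith
      rw [Real.norm_eq_abs, abs_mul]
      calc |F (t / ρ) - {t : ℝ | |t| ≤ ρ}.indicator 1 t| * |k t| ≤ 1 * (B / (ρ / 2)) :=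
            mul_le_mul h1 ((hk.size t (abs_pos.1 ht0)).trans (by gcongr)) (abs_nonneg _) zero_le_one
        _ = 2 * B / ρ := by field_simp
  have hmeas : Measurable fun t => (F (t / ρ) - {t : ℝ | |t| ≤ ρ}.indicator 1 t) * k t :=
    ((hFm.comp (measurable_id.div_const ρ)).sub
      (measurable_one.indicator hm)).mul hk.measurable
  constructor
  · rw [← integrableOn_iff_integrable_of_support_subset (s := Set.Icc (-(2 * ρ)) (2 * ρ))
      (fun t ht => by_contra fun h => ht (hoff t h))]
    exact Measure.integrableOn_of_bounded measure_Icc_lt_top.ne hmeas.aestronglyMeasurable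
      (Eventually.of_forall hbd)
  · rw [← setIntegral_eq_integral_of_forall_compl_eq_zero hoff, ← Real.norm_eq_abs]
    refine (norm_setIntegral_le_of_norm_le_const measure_Icc_lt_top
      (fun t _ => hbd t)).trans_eq ?_
    rw [Real.volume_real_Icc_of_le (by linarith)]
    field_simp
    ring

/-- Smooth and sharp annular integrals of the kernel agree up to a bounded error. -/
theorem abs_integral_cutoff_sub_shell_le {F : ℝ → ℝ} (hFm : Measurable F) (hF0 : ∀ t, 0 ≤ F t)
    (hF1 : ∀ t, F t ≤ 1) (hin : ∀ t, |t| < 1 / 2 → F t = 1) (hout : ∀ t, 2 ≤ |t| → F t = 0)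
    {r R : ℝ} (hr : 0 < r) (hR : r < R) :
    |(∫ t, (F (t / R) - F (t / r)) * k t) - ∫ t in shell r R, k t| ≤ 16 * B := by
  obtain ⟨i1, b1⟩ := hk.cutoff_sub_indicator_bounds hFm hF0 hF1 hin hout (hr.trans hR)
  obtain ⟨i2, b2⟩ := hk.cutoff_sub_indicator_bounds hFm hF0 hF1 hin hout hr
  have i3 := hk.integrable_shell hr R
  have hsplit : ∀ t, (F (t / R) - F (t / r)) * k t =
      ((F (t / R) - {t : ℝ | |t| ≤ R}.indicator 1 t) * k t -
        (F (t / r) - {t : ℝ | |t| ≤ r}.indicator 1 t) * k t) + (shell r R).indicator k t := by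
    intro t
    by_cases h1 : |t| ≤ r
    · have h2 : |t| ≤ R := h1.trans hR.le
      simp [shell, h1, h2, not_lt.2 h1]
      ring
    · by_cases h2 : |t| ≤ R
      · simp [shell, h1, h2, not_le.1 h1]
        ring
      · simp [shell, h1, h2]
        ring
  have e : ∫ t, (F (t / R) - F (t / r)) * k t =
      ((∫ t, (F (t / R) - {t : ℝ | |t| ≤ R}.indicator 1 t) * k t) -
        ∫ t, (F (t / r) - {t : ℝ | |t| ≤ r}.indicator 1 t) * k t) + ∫ t in shell r R, k t := by
    rw [← integral_indicator (measurableSet_shell r R), ← integral_sub i1 i2]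
    exact (integral_congr_ae (Eventually.of_forall hsplit)).trans (integral_add (i1.sub i2) i3)
  rw [e, add_sub_cancel_right]
  exact (abs_sub _ _).trans (by linarith)

/-- Applied to the indicator of `[-2R, 2R]`, the difference of the truncations at levels `r` and `R`
is constant on `[-R, R]`, equal to the integral of the kernel over the shell. -/
theorem abs_integral_shell_le_of_boundedTruncations {C : ℝ≥0} (hC : BoundedTruncations k C)
    {r R : ℝ} (hr : 0 < r) (hR : r < R) : |∫ t in shell r R, k t| ≤ 4 * C := by
  have hR0 : 0 < R := hr.trans hR
  set I := ∫ t in shell r R, k t with hI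
  set f : ℝ → ℝ := (Set.Icc (-(2 * R)) (2 * R)).indicator fun _ => 1 with hf
  have hf2 : MemLp f 2 := memLp_indicator_const 2 measurableSet_Icc 1
    (Or.inr measure_Icc_lt_top.ne)
  obtain ⟨m1, b1⟩ := hC r hr f hf2
  obtain ⟨m2, b2⟩ := hC R hR0 f hf2
  have hS : ∀ (a x : ℝ), MeasurableSet {y : ℝ | a < |x - y|} := fun a x =>
    measurableSet_lt measurable_const (measurable_const.sub measurable_id).norm
  have hconst : ∀ x ∈ Set.Icc (-R) R, (∫ y in {y | r < |x - y|}, k (x - y) * f y) -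
      ∫ y in {y | R < |x - y|}, k (x - y) * f y = I := by
    intro x hx
    have hint : IntegrableOn (fun y => k (x - y) * f y) {y | r < |x - y|} := by
      rw [← integrable_indicator_iff (hS r x)]
      refine (((hk.memLp_two_tail hr).comp_measurePreserving
        (Measure.measurePreserving_sub_left volume x)).integrable_mul hf2).congr
        (Eventually.of_forall fun y => ?_)
      by_cases h : r < |x - y| <;> simp [h]
    have hsub : {y : ℝ | R < |x - y|} ⊆ {y | r < |x - y|} := fun y hy => hR.trans hy
    rw [← setIntegral_sdiff (hS R x) hint hsub, hI,
      ← integral_indicator ((hS r x).diff (hS R x)),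
      ← integral_indicator (measurableSet_shell r R),
      ← integral_sub_left_eq_self ((shell r R).indicator k) volume x]
    refine integral_congr_ae (Eventually.of_forall fun y => ?_)
    by_cases h : x - y ∈ shell r R
    · have hy : y ∈ Set.Icc (-(2 * R)) (2 * R) := by
        have := abs_le.1 h.2
        constructor <;> linarith [hx.1, hx.2]
      have hy' : y ∈ {y : ℝ | r < |x - y|} \ {y | R < |x - y|} := ⟨h.1, not_lt.2 h.2⟩
      simp only [Set.indicator_of_mem h, Set.indicator_of_mem hy', hf, Set.indicator_of_mem hy,
        mul_one]
    · have hy' : y ∉ {y : ℝ | r < |x - y|} \ {y | R < |x - y|} := fun hy =>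
        h ⟨hy.1, not_lt.1 hy.2⟩
      simp only [Set.indicator_of_notMem h, Set.indicator_of_notMem hy']
  have hlow : eLpNorm ((Set.Icc (-R) R).indicator fun _ => I) 2 volume ≤
      C * eLpNorm f 2 volume + C * eLpNorm f 2 volume := by
    refine (eLpNorm_mono fun x => ?_).trans
      ((eLpNorm_sub_le m1.1 m2.1 (by norm_num)).trans (add_le_add b1 b2))
    by_cases hx : x ∈ Set.Icc (-R) R
    · rw [Set.indicator_of_mem hx, Pi.sub_apply, hconst x hx]
    · rw [Set.indicator_of_notMem hx, norm_zero]; positivity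
  rw [hf, eLpNorm_indicator_const measurableSet_Icc (by norm_num) (by norm_num),
    eLpNorm_indicator_const measurableSet_Icc (by norm_num) (by norm_num),
    Real.volume_Icc, Real.volume_Icc] at hlow
  have hsq : ENNReal.ofReal (2 * R - -(2 * R)) ^ (1 / (2 : ℝ≥0∞).toReal) ≤
      2 * ENNReal.ofReal (R - -R) ^ (1 / (2 : ℝ≥0∞).toReal) := by
    rw [ENNReal.ofReal_rpow_of_pos (by linarith), ENNReal.ofReal_rpow_of_pos (by linarith),
      ← ENNReal.ofReal_ofNat, ← ENNReal.ofReal_mul (by norm_num)]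
    refine ENNReal.ofReal_le_ofReal ?_
    rw [ENNReal.toReal_ofReal (by norm_num), ← Real.sqrt_eq_rpow, ← Real.sqrt_eq_rpow]
    refine Real.sqrt_le_iff.2 ⟨by positivity, ?_⟩
    rw [mul_pow, Real.sq_sqrt (by linarith)]
    linarith
  set a := ENNReal.ofReal (R - -R) ^ (1 / (2 : ℝ≥0∞).toReal)
  have ha0 : a ≠ 0 := by
    simp only [a, ne_eq, ENNReal.rpow_eq_zero_iff, not_or, not_and]
    refine ⟨fun h => ?_, fun h => absurd h ENNReal.ofReal_ne_top⟩
    rw [ENNReal.ofReal_eq_zero] at h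
    linarith
  have hat : a ≠ ⊤ := ENNReal.rpow_ne_top_of_nonneg (by norm_num) ENNReal.ofReal_ne_top
  have hfin : ‖I‖ₑ * a ≤ (4 * C : ℝ≥0) * a := by
    refine hlow.trans ?_
    rw [enorm_one, one_mul]
    refine (add_le_add (mul_le_mul_right hsq _) (mul_le_mul_right hsq _)).trans_eq ?_
    push_cast
    ring
  have := (ENNReal.mul_le_mul_iff_left ha0 hat).1 hfin
  rw [enorm_le_coe, ← NNReal.coe_le_coe] at this
  simpa using this

end IsRealCZKernel

/-! ### Horizontal lines as isometric copies of `ℝ` -/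

section Line

variable {E : Type*} [NormedAddCommGroup E] [NormedSpace ℝ E]
  {G : Type*} [TopologicalSpace G] [ChartedSpace E G] [Group G]

theorem IsOneParam.map_zero {X : GroupLieAlgebra 𝓘(ℝ, E) G} {γ : ℝ → G} (h : IsOneParam X γ) :
    γ 0 = 1 := by
  have := h.map_add 0 0
  rw [add_zero] at this
  exact left_eq_mul.1 this

theorem IsOneParam.comp_const_mul {X : GroupLieAlgebra 𝓘(ℝ, E) G} {γ : ℝ → G}
    (h : IsOneParam X γ) (c : ℝ) : IsOneParam (c • X) (fun t => γ (c * t)) where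
  smooth := h.smooth.comp (contDiff_const.mul contDiff_id).contMDiff
  map_add s t := by rw [mul_add, h.map_add]
  velocity := by
    have h1 : MDifferentiableAt 𝓘(ℝ, ℝ) 𝓘(ℝ, E) γ ((fun t : ℝ => c * t) 0) :=
      h.smooth.mdifferentiable (by simp) _
    have h2 : HasDerivAt (fun t : ℝ => c * t) c 0 := by
      simpa using (hasDerivAt_id (0 : ℝ)).const_mul c
    have h3 := h1.hasMFDerivAt.comp (0 : ℝ) h2.hasFDerivAt.hasMFDerivAt
    -- The base point `c * 0` of the outer derivative is moved to `0` before `velocity` applies.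
    have h4 : ∀ x : ℝ, x = 0 → mfderiv 𝓘(ℝ, ℝ) 𝓘(ℝ, E) γ x c = c • X := by
      rintro x rfl
      have h5 := (mfderiv 𝓘(ℝ, ℝ) 𝓘(ℝ, E) γ 0).map_smul c (1 : ℝ)
      rw [h.velocity] at h5
      refine Eq.trans ?_ h5
      exact congrArg _ (mul_one c).symm
    have h5 : mfderiv 𝓘(ℝ, ℝ) 𝓘(ℝ, E) (fun t => γ (c * t)) 0 = _ := h3.mfderiv
    rw [h5]
    refine Eq.trans ?_ (h4 (c * 0) (mul_zero c))
    exact congrArg (mfderiv 𝓘(ℝ, ℝ) 𝓘(ℝ, E) γ (c * 0)) (one_mul c)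

theorem IsOneParam.isExp {X : GroupLieAlgebra 𝓘(ℝ, E) G} {γ : ℝ → G} (h : IsOneParam X γ)
    (u : ℝ) : IsExp (u • X) (γ u) :=
  ⟨_, h.comp_const_mul u, by rw [mul_one]⟩

variable {s : ℕ} {S : Stratification E G s}

theorem IsOneParam.isDilate {X : GroupLieAlgebra 𝓘(ℝ, E) G} {γ : ℝ → G} (h : IsOneParam X γ)
    (hX : X ∈ S.layer 1) (t u : ℝ) : IsDilate S t (γ u) (γ (t * u)) := by
  have h1 : 1 ∈ Finset.Icc 1 s := Finset.mem_Icc.2 ⟨le_rfl, S.one_le_step⟩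
  refine ⟨fun i => if i = 1 then u • X else 0, fun i _ => ?_, ?_, ?_⟩
  · by_cases hi : i = 1
    · subst hi
      simpa using (S.layer 1).smul_mem u hX
    · simp [hi]
  · rw [Finset.sum_ite_eq' _ 1, if_pos h1]
    exact h.isExp u
  · simp only [smul_ite, smul_zero]
    rw [Finset.sum_ite_eq' (Finset.Icc 1 s) 1 fun i => t ^ i • u • X, if_pos h1, pow_one, smul_smul]
    exact h.isExp (t * u)

/-- A homogeneous metric makes the graph of the dilation single-valued. -/
theorem HomogeneousMetric.dilate_eq (D : HomogeneousMetric S) {t : ℝ} (ht : 0 < t) {p q : G}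
    (h : IsDilate S t p q) : dilate S t p = q := by
  have h1 : IsDilate S t p (dilate S t p) := Classical.epsilon_spec (p := IsDilate S t p) ⟨q, h⟩
  apply D.eq_of_d_eq_zero
  rw [D.homogeneous t ht _ _ _ _ h1 h, D.d_self, mul_zero]

/-- A curve in `G`, viewed as a curve in the metric space `(G, d)`. -/
def HomogeneousMetric.curve (D : HomogeneousMetric S) (φ : ℝ → G) : ℝ → D.Space := φ

/-- `φ` parametrizes the line `L` through `1` by arc length, as a group homomorphism on which
dilations act by multiplication. -/
structure IsLineParam (D : HomogeneousMetric S) (L : Set G) (φ : ℝ → G) : Prop where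
  continuous : Continuous φ
  map_add : ∀ s t, φ (s + t) = φ s * φ t
  d_eq : ∀ s t, D.d (φ s) (φ t) = |s - t|
  range_eq : Set.range φ = L
  dilate_eq : ∀ t, 0 < t → ∀ u, dilate S t (φ u) = φ (t * u)

theorem IsHorizontalLine.exists_isLineParam {L : Set G} (hL : IsHorizontalLine S L)
    (D : HomogeneousMetric S) : ∃ φ, IsLineParam D L φ := by
  obtain ⟨X, hX, hX0, γ, hγ, rfl⟩ := hL
  have hdil := fun t u => hγ.isDilate (S := S) hX t u
  have hpos : ∀ t, 0 < t → D.d (γ t) 1 = t * D.d (γ 1) 1 := by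
    intro t ht
    have := D.homogeneous t ht _ _ _ _ (hdil t 1) (hdil t 0)
    rwa [mul_one, mul_zero, hγ.map_zero] at this
  have habs : ∀ t, D.d (γ t) 1 = |t| * D.d (γ 1) 1 := by
    intro t
    rcases lt_trichotomy t 0 with ht | rfl | ht
    · have h1 := D.left_invariant (γ (-t)) (γ t) 1
      rw [← hγ.map_add, neg_add_cancel, hγ.map_zero, mul_one] at h1
      rw [← h1, D.d_comm, hpos (-t) (by linarith), abs_of_neg ht]
    · rw [hγ.map_zero, D.d_self, abs_zero, zero_mul]
    · rw [hpos t ht, abs_of_pos ht]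
  have hc0 : D.d (γ 1) 1 ≠ 0 := by
    -- A vanishing speed would make the one-parameter subgroup constant, with velocity `0`.
    intro hc
    have hconst : γ = fun _ => 1 := by
      ext t
      exact D.eq_of_d_eq_zero (by rw [habs t, hc, mul_zero])
    apply hX0
    rw [← hγ.velocity, hconst, mfderiv_const]
    rfl
  have hc : 0 < D.d (γ 1) 1 := by
    have := D.d_triangle (γ 1) 1 (γ 1)
    rw [D.d_self, D.d_comm 1 (γ 1)] at this
    exact lt_of_le_of_ne (by linarith) hc0.symm
  set c := D.d (γ 1) 1
  refine ⟨fun t => γ (c⁻¹ * t), ?_, fun s t => by rw [mul_add, hγ.map_add], fun s t => ?_, ?_,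
    fun t ht u => ?_⟩
  · exact hγ.smooth.continuous.comp (continuous_const.mul continuous_id)
  · have h1 := D.left_invariant (γ (-(c⁻¹ * t))) (γ (c⁻¹ * s)) (γ (c⁻¹ * t))
    rw [← hγ.map_add, ← hγ.map_add, neg_add_cancel, hγ.map_zero, habs] at h1
    rw [← h1, show -(c⁻¹ * t) + c⁻¹ * s = c⁻¹ * (s - t) by ring, abs_mul, abs_inv, abs_of_pos hc]
    field_simp
  · exact Function.Surjective.range_comp (fun x => ⟨c * x, by field_simp⟩) γ
  · rw [D.dilate_eq ht (hdil t _), mul_left_comm]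

namespace IsLineParam

variable {D : HomogeneousMetric S} {L : Set G} {φ : ℝ → G} (hφ : IsLineParam D L φ)
include hφ

theorem map_zero : φ 0 = 1 := by
  have := hφ.map_add 0 0
  rw [add_zero] at this
  exact left_eq_mul.1 this

theorem inv_mul (x y : ℝ) : (φ y)⁻¹ * φ x = φ (x - y) := by
  rw [inv_mul_eq_iff_eq_mul, ← hφ.map_add, add_sub_cancel]

theorem d_one (t : ℝ) : D.d (φ t) 1 = |t| := by
  rw [← hφ.map_zero, hφ.d_eq, sub_zero]

theorem isometry : Isometry (D.curve φ) :=
  Isometry.of_dist_eq hφ.d_eq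

theorem measurableEmbedding : MeasurableEmbedding (D.curve φ) :=
  hφ.isometry.isClosedEmbedding.measurableEmbedding

theorem lineMeasure_eq : D.lineMeasure L = Measure.map (D.curve φ) volume := by
  rw [← hausdorffMeasure_real, hφ.isometry.map_hausdorffMeasure (Or.inl zero_le_one)]
  unfold HomogeneousMetric.lineMeasure
  congr 1
  exact hφ.range_eq.symm

theorem isRealCZKernel {K : G → ℝ} {B β : ℝ} (hcont : ContinuousOn K {1}ᶜ) (hB : 0 < B)
    (hβ : 0 < β) (hsize : ∀ p : G, p ≠ 1 → |K p| ≤ B / D.d p 1)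
    (hholder : ∀ p₁ p₂ q : G, p₁ ≠ q → D.d p₁ p₂ ≤ D.d p₁ q / 2 →
      |K (q⁻¹ * p₁) - K (q⁻¹ * p₂)| + |K (p₁⁻¹ * q) - K (p₂⁻¹ * q)|
        ≤ B * (D.d p₁ p₂ ^ β / D.d p₁ q ^ (1 + β))) :
    IsRealCZKernel (K ∘ φ) B β := by
  have hne : ∀ t, t ≠ 0 → φ t ≠ 1 := by
    intro t ht h
    have := hφ.d_one t
    rw [h, D.d_self] at this
    exact ht (abs_eq_zero.1 this.symm)
  refine ⟨hcont.comp hφ.continuous.continuousOn fun t ht => hne t ht, hB, hβ, fun t ht => ?_,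
    fun t u ht htu => ?_⟩
  · have := hsize (φ t) (hne t ht)
    rwa [hφ.d_one] at this
  · have := hholder (φ t) (φ u) 1 (hne t ht) (by rwa [hφ.d_one, hφ.d_eq])
    rw [hφ.d_one, hφ.d_eq, inv_one, one_mul, one_mul] at this
    exact (le_add_of_nonneg_right (abs_nonneg _)).trans this

theorem truncatedSIO_apply (K : G → ℝ) (ε : ℝ) (f : D.Space → ℝ) (x : ℝ) :
    truncatedSIO D K (D.lineMeasure L) ε f (D.curve φ x) =
      ∫ y in {y | ε < |x - y|}, (K ∘ φ) (x - y) * f (D.curve φ y) := by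
  unfold truncatedSIO
  rw [hφ.lineMeasure_eq, hφ.measurableEmbedding.setIntegral_map]
  have hset : (D.curve φ) ⁻¹' {q : D.Space | ε < dist (D.curve φ x) q} =
      {y | ε < |x - y|} := by
    ext y
    exact (congrArg (ε < ·) (hφ.d_eq x y)).to_iff
  rw [hset]
  refine integral_congr_ae (Filter.Eventually.of_forall fun y => ?_)
  exact congrArg (fun p => K p * f (D.curve φ y)) (hφ.inv_mul x y)

theorem sioBoundedL2_iff (K : G → ℝ) (C : ℝ≥0) :
    SIOBoundedL2 D K (D.lineMeasure L) C ↔ BoundedTruncations (K ∘ φ) C := by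
  have hT : ∀ ε f, truncatedSIO D K (D.lineMeasure L) ε f ∘ (D.curve φ) =
      fun x => ∫ y in {y | ε < |x - y|}, (K ∘ φ) (x - y) * f (D.curve φ y) := fun ε f =>
    funext fun x => hφ.truncatedSIO_apply K ε f x
  have hmem : ∀ f : D.Space → ℝ, MemLp f 2 (D.lineMeasure L) ↔
      MemLp (f ∘ D.curve φ) 2 volume := fun f => by
    rw [hφ.lineMeasure_eq, hφ.measurableEmbedding.memLp_map_measure_iff]
  have hnorm : ∀ f : D.Space → ℝ, eLpNorm f 2 (D.lineMeasure L) =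
      eLpNorm (f ∘ D.curve φ) 2 volume := fun f => by
    rw [hφ.lineMeasure_eq, hφ.measurableEmbedding.eLpNorm_map_measure]
  constructor
  · intro h ε hε f hf
    -- Functions on `ℝ` are extended by zero off the line.
    have hext : Function.extend (D.curve φ) f 0 ∘ (D.curve φ) = f :=
      Function.extend_comp hφ.isometry.injective f 0
    have := h ε hε (Function.extend (D.curve φ) f 0) ((hmem _).2 (by rwa [hext]))
    rw [hmem, hnorm, hnorm, hT, hext] at this
    have he : ∀ y, Function.extend (D.curve φ) f 0 (D.curve φ y) = f y := congrFun hext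
    simpa only [he] using this
  · intro h ε hε f hf
    rw [hmem, hnorm, hnorm, hT]
    exact h ε hε (f ∘ D.curve φ) ((hmem f).1 hf)

theorem integral_annular (K ψ : G → ℝ) {r R : ℝ} (hr : 0 < r) (hR : 0 < R) :
    ∫ p : D.Space, (ψ (dilate S (1 / R) p) - ψ (dilate S (1 / r) p)) * K p ∂(D.lineMeasure L) =
      ∫ t, ((ψ ∘ φ) (t / R) - (ψ ∘ φ) (t / r)) * (K ∘ φ) t := by
  rw [hφ.lineMeasure_eq, hφ.measurableEmbedding.integral_map]
  refine integral_congr_ae (Filter.Eventually.of_forall fun t => ?_)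
  change (ψ (dilate S (1 / R) (φ t)) - ψ (dilate S (1 / r) (φ t))) * K (φ t) =
    (ψ (φ (t / R)) - ψ (φ (t / r))) * K (φ t)
  rw [hφ.dilate_eq _ (one_div_pos.2 hR), hφ.dilate_eq _ (one_div_pos.2 hr), one_div_mul_eq_div,
    one_div_mul_eq_div]

end IsLineParam

end Line

/-! ### Annular boundedness and sharp annular integrals -/

section Equivalence

variable {E : Type*} [NormedAddCommGroup E] [NormedSpace ℝ E]
  {G : Type*} [TopologicalSpace G] [ChartedSpace E G] [Group G]
  {s : ℕ} {S : Stratification E G s} {D : HomogeneousMetric S}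

theorem IsLineParam.abs_integral_annular_sub_shell_le {L : Set G} {φ : ℝ → G}
    (hφ : IsLineParam D L φ) {K ψ : G → ℝ} {B β : ℝ} (hk : IsRealCZKernel (K ∘ φ) B β)
    (hψ : IsCutoff D ψ) (hm : Measurable (ψ ∘ φ)) {r R : ℝ} (hr : 0 < r) (hR : r < R) :
    |(∫ p : D.Space, (ψ (dilate S (1 / R) p) - ψ (dilate S (1 / r) p)) * K p ∂(D.lineMeasure L)) -
      ∫ t in shell r R, (K ∘ φ) t| ≤ 16 * B := by
  rw [hφ.integral_annular K ψ hr (hr.trans hR)]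
  have hlow := fun t => (hψ (φ t)).1
  have hup := fun t => (hψ (φ t)).2
  have hle : ∀ t, ψ (φ t) ≤ 1 := fun t =>
    (hup t).trans (Set.indicator_le_self' (fun _ _ => zero_le_one) _)
  have hge : ∀ t, 0 ≤ ψ (φ t) := fun t =>
    (Set.indicator_nonneg (fun _ _ => zero_le_one) _).trans (hlow t)
  refine hk.abs_integral_cutoff_sub_shell_le hm hge hle (fun t ht => ?_) (fun t ht => ?_) hr hR
  · refine le_antisymm (hle t) (le_trans (le_of_eq ?_) (hlow t))
    rw [Set.indicator_of_mem]
    change D.d (φ t) 1 < 1 / 2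
    rwa [hφ.d_one]
  · refine le_antisymm ((hup t).trans (le_of_eq ?_)) (hge t)
    rw [Set.indicator_of_notMem]
    change ¬ D.d (φ t) 1 < 2
    rw [hφ.d_one]
    exact not_lt.2 ht

/-- UBHL is equivalent to annular boundedness for any non-empty class of cutoffs that are measurable
along lines. -/
theorem isUBHL_iff_annularBoundedness {K : G → ℝ} (hK : IsCZKernel D K) {Ψ : Set (G → ℝ)}
    (hne : Ψ.Nonempty) (hcut : ∀ ψ ∈ Ψ, IsCutoff D ψ)
    (hmeas : ∀ ψ ∈ Ψ, ∀ L φ, IsLineParam D L φ → Measurable (ψ ∘ φ)) :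
    IsUBHL D K ↔ AnnularBoundedness D Ψ K := by
  obtain ⟨hcont, B, hB, β, hβ, -, hsize, hholder⟩ := hK
  constructor
  · rintro ⟨C, hC⟩ ψ hψ
    refine ⟨max 1 (4 * C + 16 * B), le_max_left _ _, fun L hL r R hr hR => ?_⟩
    obtain ⟨φ, hφ⟩ := hL.exists_isLineParam D
    have hk := hφ.isRealCZKernel hcont hB hβ hsize hholder
    have h1 := hk.abs_integral_shell_le_of_boundedTruncations
      ((hφ.sioBoundedL2_iff K C).1 (hC L hL)) hr hR
    have h2 := hφ.abs_integral_annular_sub_shell_le hk (hcut ψ hψ) (hmeas ψ hψ L φ hφ) hr hR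
    refine le_trans ?_ (le_max_right _ _)
    have h3 := abs_sub_abs_le_abs_sub
      (∫ p : D.Space, (ψ (dilate S (1 / R) p) - ψ (dilate S (1 / r) p)) * K p ∂(D.lineMeasure L))
      (∫ t in shell r R, (K ∘ φ) t)
    linarith
  · intro h
    obtain ⟨ψ, hψ⟩ := hne
    obtain ⟨A, -, hA⟩ := h ψ hψ
    refine ⟨(A + 16 * B + 4 * Real.pi * B + (B / β + 2 * B)).toNNReal, fun L hL => ?_⟩
    obtain ⟨φ, hφ⟩ := hL.exists_isLineParam D
    have hk := hφ.isRealCZKernel hcont hB hβ hsize hholder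
    rw [hφ.sioBoundedL2_iff]
    refine hk.boundedTruncations (A := A + 16 * B) (fun r R hr hR => ?_) (Real.le_coe_toNNReal _)
    have h1 := hA L hL r R hr hR
    have h2 := hφ.abs_integral_annular_sub_shell_le hk (hcut ψ hψ) (hmeas ψ hψ L φ hφ) hr hR
    have h3 := abs_sub_abs_le_abs_sub (∫ t in shell r R, (K ∘ φ) t)
      (∫ p : D.Space, (ψ (dilate S (1 / R) p) - ψ (dilate S (1 / r) p)) * K p ∂(D.lineMeasure L))
    rw [abs_sub_comm] at h3
    linarith

theorem smoothProfileCutoffs_nonempty (D : HomogeneousMetric S) :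
    (smoothProfileCutoffs D).Nonempty := by
  refine ⟨fun p => Real.smoothTransition (2 - D.d p 1),
    ⟨fun x => Real.smoothTransition (2 - x), ?_, fun p => rfl⟩, fun p => ⟨?_, ?_⟩⟩
  · exact (Real.smoothTransition.contDiff.comp (contDiff_const.sub contDiff_id)).contDiffOn
  · by_cases h : D.d p 1 < 1 / 2
    · rw [Set.indicator_of_mem (s := {q : G | D.d q 1 < 1 / 2}) h]
      exact (Real.smoothTransition.one_of_one_le (by linarith)).ge
    · rw [Set.indicator_of_notMem (s := {q : G | D.d q 1 < 1 / 2}) h]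
      exact Real.smoothTransition.nonneg _
  · by_cases h : D.d p 1 < 2
    · rw [Set.indicator_of_mem (s := {q : G | D.d q 1 < 2}) h]
      exact Real.smoothTransition.le_one _
    · rw [Set.indicator_of_notMem (s := {q : G | D.d q 1 < 2}) h]
      exact (Real.smoothTransition.zero_of_nonpos (by linarith)).le

theorem IsLineParam.measurable_comp_of_mem_smoothProfileCutoffs {L : Set G} {φ : ℝ → G}
    (hφ : IsLineParam D L φ) {ψ : G → ℝ} (hψ : ψ ∈ smoothProfileCutoffs D) :
    Measurable (ψ ∘ φ) := by
  obtain ⟨⟨f, hf, hψf⟩, -⟩ := hψ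
  have : ψ ∘ φ = fun t => f |t| := by
    ext t
    rw [Function.comp_apply, hψf, hφ.d_one]
  rw [this]
  exact (hf.continuousOn.comp_continuous continuous_abs abs_nonneg).measurable

end Equivalence

end Carnot

theorem proposition2p9
    {E : Type*} [NormedAddCommGroup E] [NormedSpace ℝ E] [FiniteDimensional ℝ E]
    {G : Type*} [TopologicalSpace G] [ChartedSpace E G] [Group G] [LieGroup 𝓘(ℝ, E) ∞ G]
    [T2Space G] [SimplyConnectedSpace G]
    {s : ℕ} (S : Carnot.Stratification E G s) (D : Carnot.HomogeneousMetric S)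
    (K : G → ℝ) (hK : Carnot.IsCZKernel D K) :
    (Carnot.IsUBHL D K ↔ Carnot.AnnularBoundedness D (Carnot.smoothProfileCutoffs D) K) ∧
    ((Carnot.smoothRadialCutoffs D).Nonempty →
      (Carnot.IsUBHL D K ↔ Carnot.AnnularBoundedness D (Carnot.smoothRadialCutoffs D) K)) :=
  ⟨Carnot.isUBHL_iff_annularBoundedness hK (Carnot.smoothProfileCutoffs_nonempty D)
      (fun _ hψ => hψ.2) fun _ hψ _ _ hφ => hφ.measurable_comp_of_mem_smoothProfileCutoffs hψ,
    fun hne => Carnot.isUBHL_iff_annularBoundedness hK hne (fun _ hψ => hψ.2.2)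
      fun _ hψ _ _ hφ => (hψ.2.1.continuous.comp hφ.continuous).measurable⟩
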